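/- Let $-\infty\le a<b\le\infty$, let $w>0$ a.e. on $(a,b)$ with $w\in L^1_{\mathrm{loc}}(a,b)$, and let $\ell_0$ be a formally symmetric differential expression of order $2N$, $N\ge1$, $$\ell_0[f]=\frac1w\sum_{j=0}^{N}(-1)^j\bigl(a_jf^{(j)}\bigr)^{(j)},$$ with real coefficients such that $a_N\neq0$ a.e. and $1/a_N,a_0,\dots,a_{N-1}\in L^1_{\mathrm{loc}}(a,b)$; it is understood through its quasi-derivatives. (For $N=1$, $a_1=p$, $a_0=-q$ this is the Sturm–Liouville expression $-\frac1w\left((pf')'+qf\right)$.) Let $\ell=\ell_0^n$, $n\ge1$, be the $n$-fold composition. In the Hilbert space $L^2[(a,b),w]$ let $\mathcal D_{\max}$ be the set of all $f\in L^2[(a,b),w]$ such that all quasi-derivatives of order less than $2N$ of $f,\ell_0[f],\dots,\ell_0^{n-1}[f]$ are locally absolutely continuous on $(a,b)$ and $\ell[f]\in L^2[(a,b),w]$. For $f,g\in\mathcal D_{\max}$ put $$[f,g]\Big|_a^b=\lim_{\alpha\to a^+,\ \beta\to b^-}\int_\alpha^\beta\bigl\{\ell[f]\,\overline g-\overline{\ell[g]}\,f\bigr\}\,w\,dx,$$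 $$\mathcal D_{\min}=\bigl\{f\in\mathcal D_{\max}:[f,g]\big|_a^b=0\ \text{ for all } g\in\mathcal D_{\max}\bigr\},$$ and let $\mathbf L_{\max}=\{\ell,\mathcal D_{\max}\}$ and $\mathbf L_{\min}=\{\ell,\mathcal D_{\min}\}$ be the operators given by $\ell$ on these domains. Assume that $\mathbf L_{\min}$ has deficiency indices $(m,m)$, that is, $\dim\{f:\mathbf L_{\min}^*f=if\}=\dim\{f:\mathbf L_{\min}^*f=-if\}=m<\infty$. Let $\mathbf L$ be a self-adjoint operator in $L^2[(a,b),w]$ with domain $\mathcal D_{\mathbf L}$ and $\mathbf L_{\min}\subseteq\mathbf L\subseteq\mathbf L_{\max}$; for example, an operator $\mathbf L=\mathbf A^n$ from left-definite theory, where $\mathbf A$ is a self-adjoint operator acting by $\ell_0$ that is bounded below by a positive constant. Suppose that $\mathcal D_{\mathbf L}$ contains a sequence $\{P_k\}_{k=0}^\infty$ of non-zero, pairwise orthogonal eigenfunctions of $\mathbf L$ whose span is dense in $L^2[(a,b),w]$. Then there are $m$ distinct indices $k_1,\dots,k_m$ such that $P_{k_1},\dots,P_{k_m}$ are linearly independent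 modulo $\mathcal D_{\min}$ (no non-trivial linear combination of them lies in $\mathcal D_{\min}$), satisfy the Glazman symmetry conditions $[P_{k_i},P_{k_j}]\big|_a^b=0$ for $1\le i,j\le m$, and $$\mathcal D_{\mathbf L}=\bigl\{f\in\mathcal D_{\max}:[f,P_{k_i}]\big|_a^b=0,\ i=1,\dots,m\bigr\}.$$ -/

import Mathlib

open MeasureTheory Filter Topology

namespace GKN

/-- The real points of the open interval `(a, b)`, whose endpoints may be infinite. -/
def interval (a b : EReal) : Set ℝ := {x : ℝ | a < (x : EReal) ∧ (x : EReal) < b}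

/-- `f` belongs to `AC_loc(a, b)`: it is absolutely continuous on every compact subinterval. -/
def LocAbsCont (a b : EReal) (f : ℝ → ℂ) : Prop :=
  ∀ c ∈ interval a b, ∀ d ∈ interval a b, AbsolutelyContinuousOnInterval f c d

/-- The data of a formally symmetric differential expression of order `2 N` on `(a, b)` in
Lagrangian form, with weight `w` and real coefficients `a_0, …, a_N`,
`ℓ f = (1 / w) ∑_{j ≤ N} (-1)^j (a_j f^{(j)})^{(j)}`.
For `N = 1`, `a_1 = p` and `a_0 = -q` it is the Sturm-Liouville expression
`ℓ f = -(1 / w) ((p f')' + q f)`. Only the coefficients with index at most `N` matter. -/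
structure SymmExpr (N : ℕ) where
  a : EReal
  b : EReal
  coeff : ℕ → ℝ → ℝ
  w : ℝ → ℝ
  a_lt_b : a < b
  lead_ne_zero : ∀ᵐ x ∂(volume.restrict (interval a b)), coeff N x ≠ 0
  inv_lead_locallyIntegrable : LocallyIntegrableOn (fun x => (coeff N x)⁻¹) (interval a b)
  coeff_locallyIntegrable : ∀ j < N, LocallyIntegrableOn (coeff j) (interval a b)
  w_pos : ∀ᵐ x ∂(volume.restrict (interval a b)), 0 < w x
  w_locallyIntegrable : LocallyIntegrableOn w (interval a b)

namespace SymmExpr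

variable {N : ℕ} (τ : SymmExpr N)

/-- Lebesgue measure on `(a, b)`. -/
noncomputable abbrev leb : Measure ℝ := volume.restrict (interval τ.a τ.b)

/-- The measure `w(x) dx` on `(a, b)`. -/
noncomputable def weightMeasure : Measure ℝ :=
  τ.leb.withDensity fun x => ENNReal.ofReal (τ.w x)

/-- The Hilbert space `L²[(a, b), w]`. -/
abbrev Space : Type := Lp ℂ 2 τ.weightMeasure

/-- The derivative of the `k`-th quasi-derivative in terms of the list `φ` of quasi-derivatives
`φ 0 = f, …, φ (2 N - 1)` and of `φ (2 N) = w * ℓ f`. For smooth coefficients, `φ k = f^{(k)}` for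
`k < N`, `φ N = a_N f^{(N)}` and `φ (N + j) = a_{N-j} f^{(N-j)} - (φ (N + j - 1))'`. -/
noncomputable def quasiDeriv (φ : ℕ → ℝ → ℂ) (k : ℕ) (x : ℝ) : ℂ :=
  if k + 1 < N then φ (k + 1) x
  else if k + 1 = N then φ N x / (τ.coeff N x : ℂ)
  else (τ.coeff (2 * N - 1 - k) x : ℂ) * φ (2 * N - 1 - k) x - φ (k + 1) x

/-- `f` and its quasi-derivatives of order less than `2 N` are in `AC_loc(a, b)` (after a change of
`f` on a null set), and `ℓ f = g` almost everywhere on `(a, b)`. -/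
def Applies (f g : ℝ → ℂ) : Prop :=
  ∃ φ : ℕ → ℝ → ℂ,
    φ 0 =ᵐ[τ.leb] f ∧
    (∀ k < 2 * N, LocAbsCont τ.a τ.b (φ k)) ∧
    (∀ k < 2 * N, ∀ᵐ x ∂τ.leb, HasDerivAt (φ k) (τ.quasiDeriv φ k x) x) ∧
    φ (2 * N) =ᵐ[τ.leb] fun x => (τ.w x : ℂ) * g x

/-- `ℓ^n f = g`, where `ℓ^n` is `ℓ` composed with itself `n` times. All quasi-derivatives of
`f, ℓ f, …, ℓ^{n-1} f` of order less than `2 N` are in `AC_loc(a, b)`. -/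
def AppliesPow : ℕ → (ℝ → ℂ) → (ℝ → ℂ) → Prop
  | 0, f, g => f =ᵐ[τ.leb] g
  | n + 1, f, g => ∃ h, τ.Applies f h ∧ AppliesPow n h g

variable {τ}

theorem quasiDeriv_add (φ ψ : ℕ → ℝ → ℂ) (k : ℕ) (x : ℝ) :
    τ.quasiDeriv (fun j y => φ j y + ψ j y) k x = τ.quasiDeriv φ k x + τ.quasiDeriv ψ k x := by
  unfold quasiDeriv; split_ifs <;> ring

theorem quasiDeriv_smul (c : ℂ) (φ : ℕ → ℝ → ℂ) (k : ℕ) (x : ℝ) :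
    τ.quasiDeriv (fun j y => c * φ j y) k x = c * τ.quasiDeriv φ k x := by
  unfold quasiDeriv; split_ifs <;> ring

theorem Applies.add {f g f' g' : ℝ → ℂ} (h : τ.Applies f g) (h' : τ.Applies f' g') :
    τ.Applies (f + f') (g + g') := by
  obtain ⟨φ, h0, hac, hd, hw⟩ := h
  obtain ⟨ψ, h0', hac', hd', hw'⟩ := h'
  refine ⟨fun j y => φ j y + ψ j y, ?_, ?_, ?_, ?_⟩
  · filter_upwards [h0, h0'] with x hx hx'
    simp [hx, hx']
  · intro k hk c hc d hd
    exact (hac k hk c hc d hd).add (hac' k hk c hc d hd)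
  · intro k hk
    filter_upwards [hd k hk, hd' k hk] with x hx hx'
    rw [quasiDeriv_add]
    exact hx.add hx'
  · filter_upwards [hw, hw'] with x hx hx'
    simp [hx, hx', mul_add]

theorem Applies.smul {f g : ℝ → ℂ} (c : ℂ) (h : τ.Applies f g) : τ.Applies (c • f) (c • g) := by
  obtain ⟨φ, h0, hac, hd, hw⟩ := h
  refine ⟨fun j y => c * φ j y, ?_, ?_, ?_, ?_⟩
  · filter_upwards [h0] with x hx
    simp [hx]
  · intro k hk s hs t ht
    exact (hac k hk s hs t ht).const_smul c
  · intro k hk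
    filter_upwards [hd k hk] with x hx
    rw [quasiDeriv_smul]
    exact hx.const_mul c
  · filter_upwards [hw] with x hx
    simp only [hx, Pi.smul_apply, smul_eq_mul]
    ring

theorem Applies.congr {f g f' g' : ℝ → ℂ} (h : τ.Applies f g) (hf : f =ᵐ[τ.leb] f')
    (hg : g =ᵐ[τ.leb] g') : τ.Applies f' g' := by
  obtain ⟨φ, h0, hac, hd, hw⟩ := h
  refine ⟨φ, h0.trans hf, hac, hd, ?_⟩
  filter_upwards [hw, hg] with x hx hx'
  rw [hx, hx']

theorem isOpen_interval (a b : EReal) : IsOpen (interval a b) :=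
  (isOpen_lt continuous_const continuous_coe_real_ereal).inter
    (isOpen_lt continuous_coe_real_ereal continuous_const)

theorem LocAbsCont.eqOn_zero {a b : EReal} {f : ℝ → ℂ} (hf : LocAbsCont a b f)
    (h : f =ᵐ[volume.restrict (interval a b)] 0) : Set.EqOn f 0 (interval a b) := by
  have hc : ContinuousOn f (interval a b) := by
    intro x hx
    obtain ⟨ε, hε, hball⟩ := Metric.isOpen_iff.1 (isOpen_interval a b) x hx
    have hm : x - ε / 2 ∈ interval a b := hball (by
      rw [Metric.mem_ball, Real.dist_eq, abs_lt]; constructor <;> linarith)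
    have hp : x + ε / 2 ∈ interval a b := hball (by
      rw [Metric.mem_ball, Real.dist_eq, abs_lt]; constructor <;> linarith)
    have h1 := (hf _ hm _ hp).continuousOn
    rw [Set.uIcc_of_le (by linarith)] at h1
    exact (h1.continuousAt (Icc_mem_nhds (by linarith) (by linarith))).continuousWithinAt
  exact Measure.eqOn_open_of_ae_eq h (isOpen_interval a b) hc continuousOn_const

theorem Applies.ae_zero {f g : ℝ → ℂ} (h : τ.Applies f g)
    (hf : f =ᵐ[τ.leb] 0) : g =ᵐ[τ.leb] 0 := by
  obtain ⟨φ, h0, hac, hd, hw⟩ := h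
  have hI : MeasurableSet (interval τ.a τ.b) := (isOpen_interval _ _).measurableSet
  have hmem : ∀ᵐ x ∂τ.leb, x ∈ interval τ.a τ.b := ae_restrict_mem hI
  have key : ∀ k ≤ 2 * N, ∀ j ≤ k, φ j =ᵐ[τ.leb] 0 := by
    intro k
    induction k with
    | zero =>
      intro _ j hj
      obtain rfl : j = 0 := by omega
      exact h0.trans hf
    | succ k ih =>
      intro hk j hj
      have ih' := ih (by omega)
      rcases Nat.lt_or_ge j (k + 1) with hlt | hge
      · exact ih' j (by omega)
      obtain rfl : j = k + 1 := by omega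
      have hz := LocAbsCont.eqOn_zero (hac k (by omega)) (ih' k le_rfl)
      have hder : ∀ᵐ x ∂τ.leb, τ.quasiDeriv φ k x = 0 := by
        filter_upwards [hd k (by omega), hmem] with x hx hxI
        have : HasDerivAt (φ k) 0 x :=
          (hasDerivAt_const x (0 : ℂ)).congr_of_eventuallyEq
            (hz.eventuallyEq_of_mem ((isOpen_interval _ _).mem_nhds hxI))
        exact hx.unique this
      unfold quasiDeriv at hder
      split_ifs at hder with h1 h2
      · exact hder
      · filter_upwards [hder, τ.lead_ne_zero] with x hx hx'
        rw [h2]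
        simpa [hx'] using hx
      · filter_upwards [hder, ih' (2 * N - 1 - k) (by omega)] with x hx hx'
        rw [hx'] at hx
        simpa using hx
  filter_upwards [key (2 * N) le_rfl (2 * N) le_rfl, hw, τ.w_pos] with x h1 h2 h3
  rw [h1] at h2
  have h4 : (τ.w x : ℂ) ≠ 0 := by exact_mod_cast h3.ne'
  simpa [h4] using h2.symm

theorem AppliesPow.add {n : ℕ} {f g f' g' : ℝ → ℂ} (h : τ.AppliesPow n f g)
    (h' : τ.AppliesPow n f' g') : τ.AppliesPow n (f + f') (g + g') := by
  induction n generalizing f f' with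
  | zero => exact EventuallyEq.add h h'
  | succ n ih =>
    obtain ⟨u, hu, hu'⟩ := h
    obtain ⟨v, hv, hv'⟩ := h'
    exact ⟨u + v, hu.add hv, ih hu' hv'⟩

theorem AppliesPow.smul {n : ℕ} {f g : ℝ → ℂ} (c : ℂ) (h : τ.AppliesPow n f g) :
    τ.AppliesPow n (c • f) (c • g) := by
  induction n generalizing f with
  | zero => exact EventuallyEq.const_smul h c
  | succ n ih =>
    obtain ⟨u, hu, hu'⟩ := h
    exact ⟨c • u, hu.smul c, ih hu'⟩

theorem AppliesPow.ae_zero {n : ℕ} {f g : ℝ → ℂ} (h : τ.AppliesPow n f g)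
    (hf : f =ᵐ[τ.leb] 0) : g =ᵐ[τ.leb] 0 := by
  induction n generalizing f with
  | zero => exact (EventuallyEq.symm h).trans hf
  | succ n ih =>
    obtain ⟨u, hu, hu'⟩ := h
    exact ih hu' (hu.ae_zero hf)

theorem AppliesPow.congr {n : ℕ} {f g f' g' : ℝ → ℂ} (h : τ.AppliesPow n f g)
    (hf : f =ᵐ[τ.leb] f') (hg : g =ᵐ[τ.leb] g') : τ.AppliesPow n f' g' := by
  induction n generalizing f f' with
  | zero => exact (hf.symm.trans h).trans hg
  | succ n ih =>
    obtain ⟨u, hu, hu'⟩ := h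
    exact ⟨u, hu.congr hf EventuallyEq.rfl, ih hu' EventuallyEq.rfl⟩

theorem leb_absolutelyContinuous : τ.leb ≪ τ.weightMeasure := by
  refine withDensity_absolutelyContinuous' ?_ ?_
  · have hw : AEStronglyMeasurable τ.w τ.leb := τ.w_locallyIntegrable.aestronglyMeasurable
    exact hw.aemeasurable.ennreal_ofReal
  · filter_upwards [τ.w_pos] with x hx
    simpa using hx

variable (τ) (n : ℕ)

/-- The graph of the maximal operator of `ℓ^n`: all pairs `(f, ℓ^n f)` such that `f` and `ℓ^n f` lie
in `L²[(a, b), w]`. -/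
noncomputable def maxGraph : Submodule ℂ (τ.Space × τ.Space) where
  carrier := {z | τ.AppliesPow n z.1 z.2}
  zero_mem' := by
    have h0 : ∀ m, τ.AppliesPow m 0 0 := by
      intro m
      induction m with
      | zero => exact EventuallyEq.rfl
      | succ m ih =>
        refine ⟨0, ⟨0, EventuallyEq.rfl, ?_, ?_, ?_⟩, ih⟩
        · intro k _ c _ d _
          simpa [AbsolutelyContinuousOnInterval] using tendsto_const_nhds
        · intro k _
          refine Eventually.of_forall fun x => ?_
          have : τ.quasiDeriv 0 k x = 0 := by unfold quasiDeriv; split_ifs <;> simp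
          rw [this]
          exact hasDerivAt_const x (0 : ℂ)
        · exact Eventually.of_forall fun x => by simp
    exact (h0 n).congr (leb_absolutelyContinuous.ae_eq (Lp.coeFn_zero ℂ 2 _)).symm
      (leb_absolutelyContinuous.ae_eq (Lp.coeFn_zero ℂ 2 _)).symm
  add_mem' {z z'} hz hz' :=
    (AppliesPow.add hz hz').congr (leb_absolutelyContinuous.ae_eq (Lp.coeFn_add z.1 z'.1)).symm
      (leb_absolutelyContinuous.ae_eq (Lp.coeFn_add z.2 z'.2)).symm
  smul_mem' c z hz :=
    (AppliesPow.smul c hz).congr (leb_absolutelyContinuous.ae_eq (Lp.coeFn_smul c z.1)).symm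
      (leb_absolutelyContinuous.ae_eq (Lp.coeFn_smul c z.2)).symm

/-- The maximal operator `{ℓ^n, 𝒟_max}` in `L²[(a, b), w]`. -/
noncomputable def maxOp : τ.Space →ₗ.[ℂ] τ.Space := (τ.maxGraph n).toLinearPMap

/-- The junk value in the passage from a graph to an operator is never used. -/
theorem maxOp_graph : (τ.maxGraph n).toLinearPMap.graph = τ.maxGraph n := by
  refine Submodule.toLinearPMap_graph_eq _ fun z hz hz0 => ?_
  have h1 : (z.1 : ℝ → ℂ) =ᵐ[τ.leb] 0 := by
    rw [hz0]
    exact leb_absolutelyContinuous.ae_eq (Lp.coeFn_zero ℂ 2 _)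
  have h2 := AppliesPow.ae_zero hz h1
  refine (Lp.eq_zero_iff_ae_eq_zero).2 ?_
  exact (withDensity_absolutelyContinuous _ _).ae_eq h2

variable {τ n}

theorem mem_maxOp_graph {u v : τ.Space} :
    (u, v) ∈ (τ.maxOp n).graph ↔ τ.AppliesPow n u v := by
  rw [maxOp, maxOp_graph]
  rfl

/-- The sesquilinear form on a subinterval, given by Green's formula:
`[f, g]_n |_α^β = ∫_α^β (ℓ^n[f] conj(g) - conj(ℓ^n[g]) f) w dx`. -/
noncomputable def greenForm (f g : (τ.maxOp n).domain) (α β : ℝ) : ℂ :=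
  ∫ x in α..β, ((τ.maxOp n f : τ.Space) x * (starRingEnd ℂ) ((g : τ.Space) x)
    - (starRingEnd ℂ) ((τ.maxOp n g : τ.Space) x) * (f : τ.Space) x) ∂τ.weightMeasure

/-- `[f, g]_n |_a^b = c`, i.e. `[f, g]_n |_α^β → c` as `α → a+` and `β → b-`. -/
def HasBoundaryForm (f g : (τ.maxOp n).domain) (c : ℂ) : Prop :=
  Tendsto (fun t : ℝ × ℝ => greenForm f g t.1 t.2)
    (comap Real.toEReal (𝓝[>] τ.a) ×ˢ comap Real.toEReal (𝓝[<] τ.b)) (𝓝 c)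

theorem integrable_mul_conj (u v : τ.Space) :
    Integrable (fun x => u x * (starRingEnd ℂ) (v x)) τ.weightMeasure :=
  L2.integrable_inner (𝕜 := ℂ) v u

theorem integrable_green (f g : (τ.maxOp n).domain) :
    Integrable (fun x => (τ.maxOp n f : τ.Space) x * (starRingEnd ℂ) ((g : τ.Space) x)
      - (starRingEnd ℂ) ((τ.maxOp n g : τ.Space) x) * (f : τ.Space) x) τ.weightMeasure := by
  refine (integrable_mul_conj _ _).sub ?_
  simpa only [mul_comm] using integrable_mul_conj (f : τ.Space) (τ.maxOp n g)

theorem greenForm_add (f f' g : (τ.maxOp n).domain) (α β : ℝ) :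
    greenForm (f + f') g α β = greenForm f g α β + greenForm f' g α β := by
  unfold greenForm
  rw [← intervalIntegral.integral_add (integrable_green f g).intervalIntegrable
    (integrable_green f' g).intervalIntegrable]
  refine intervalIntegral.integral_congr_ae ?_
  have h1 := Lp.coeFn_add (f : τ.Space) f'
  have h2 := Lp.coeFn_add (τ.maxOp n f) (τ.maxOp n f')
  filter_upwards [h1, h2] with x hx hx' _
  rw [LinearPMap.map_add, Submodule.coe_add, hx, hx']
  simp only [Pi.add_apply]
  ring

theorem greenForm_smul (c : ℂ) (f g : (τ.maxOp n).domain) (α β : ℝ) :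
    greenForm (c • f) g α β = c * greenForm f g α β := by
  unfold greenForm
  rw [← intervalIntegral.integral_const_mul]
  refine intervalIntegral.integral_congr_ae ?_
  have h1 := Lp.coeFn_smul c (f : τ.Space)
  have h2 := Lp.coeFn_smul c (τ.maxOp n f)
  filter_upwards [h1, h2] with x hx hx' _
  rw [LinearPMap.map_smul, Submodule.coe_smul, hx, hx']
  simp only [Pi.smul_apply, smul_eq_mul]
  ring

variable (τ n)

/-- The minimal domain
`𝒟_min = {f ∈ 𝒟_max | [f, g]_n |_a^b = 0 for all g ∈ 𝒟_max}`. -/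
noncomputable def minDomain : Submodule ℂ τ.Space :=
  Submodule.map (τ.maxOp n).domain.subtype
    { carrier := {f | ∀ g, HasBoundaryForm f g 0}
      zero_mem' := fun g => by
        have h : ∀ α β, greenForm (0 : (τ.maxOp n).domain) g α β = 0 := fun α β => by
          simpa using greenForm_smul 0 (0 : (τ.maxOp n).domain) g α β
        simp only [HasBoundaryForm, h]
        exact tendsto_const_nhds
      add_mem' := fun {f f'} hf hf' g => by
        simpa only [HasBoundaryForm, greenForm_add, add_zero] using Tendsto.add (hf g) (hf' g)
      smul_mem' := fun c f hf g => by
        simpa only [HasBoundaryForm, greenForm_smul, mul_zero] using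
          Tendsto.const_mul c (hf g) }

/-- The minimal operator `{ℓ^n, 𝒟_min}`. -/
noncomputable def minOp : τ.Space →ₗ.[ℂ] τ.Space := (τ.maxOp n).domRestrict (τ.minDomain n)

end SymmExpr

/-- The space of all `f ∈ 𝒟(A*)` with `A* f = z f`; membership of `(f, z f)` in the graph of the
adjoint means `⟪A u, f⟫ = ⟪u, z f⟫` for all `u ∈ 𝒟(A)`. The positive and the negative defect space
of `A` are the cases `z = i` and `z = -i`. -/
noncomputable def defectSpace {H : Type*} [NormedAddCommGroup H] [InnerProductSpace ℂ H]
    (A : H →ₗ.[ℂ] H) (z : ℂ) : Submodule ℂ H :=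
  A.graph.adjoint.comap (LinearMap.prod LinearMap.id (z • LinearMap.id))

/-- For densely defined `A`, `defectSpace A z` is an eigenspace of the adjoint operator `A†`. -/
theorem mem_defectSpace_iff {H : Type*} [NormedAddCommGroup H] [InnerProductSpace ℂ H]
    [CompleteSpace H] {A : H →ₗ.[ℂ] H} (hA : Dense (A.domain : Set H)) {z : ℂ} {f : H} :
    f ∈ defectSpace A z ↔ ∃ h : f ∈ A.adjoint.domain, A.adjoint ⟨f, h⟩ = z • f := by
  simp [defectSpace, ← LinearPMap.adjoint_graph_eq_graph_adjoint hA, LinearPMap.mem_graph_iff]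

/-- `A` has deficiency indices `(m, m)`. -/
def HasDeficiencyIndices {H : Type*} [NormedAddCommGroup H] [InnerProductSpace ℂ H]
    (A : H →ₗ.[ℂ] H) (m : ℕ) : Prop :=
  Module.rank ℂ (defectSpace A Complex.I) = m ∧ Module.rank ℂ (defectSpace A (-Complex.I)) = m

/-- `x_1, …, x_r` are linearly independent modulo the subspace `X`. -/
def LinIndepModulo {V : Type*} [AddCommGroup V] [Module ℂ V] (X : Submodule ℂ V) {r : ℕ}
    (x : Fin r → V) : Prop :=
  ∀ c : Fin r → ℂ, ∑ i, c i • x i ∈ X → ∀ i, c i = 0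

end GKN

/-! Work modulo the minimal domain `D`, the radical of the boundary form. Let `K = ker (L_min* -
i)`, the orthogonal complement of `ran (L_min + i)`, of dimension `m`, and let `Q` be the projection
onto `K`. Since `Q` is continuous and the eigenfunctions span a dense subspace, some `m` of their
projections form a basis of `K`.

On an eigenfunction `L + i` is multiplication by `λ + i ≠ 0`, so `Q (L + i)` sends the chosen
eigenfunctions to a basis of `K` as well. It kills `D`, which gives independence modulo `D`.
Conversely, if `Q (L + i) u = 0`, then `u ∈ D` (`mem_of_shift_mem_orthogonal`), because `L + i` is
bounded below and `D` is closed in the graph norm. Hence `D_L` is `D` plus the span of the chosen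
eigenfunctions.

So `m` boundary conditions on `f` make its form vanish against all of `D_L`, which puts `f` in the
domain of `L* = L`. -/

namespace GKN

/-! ### Boundary forms and defect spaces in Hilbert space -/

section Abstract

variable {H : Type*} [NormedAddCommGroup H] [InnerProductSpace ℂ H]

/-- The boundary form `⟪A f, g⟫ - ⟪f, A g⟫` (linear in `f`, conjugate linear in `g`) of an operator
`A`. -/
noncomputable def boundaryForm (A : H →ₗ.[ℂ] H) (f g : A.domain) : ℂ :=
  inner ℂ (g : H) (A f) - inner ℂ (A g) (f : H)

theorem boundaryForm_swap (A : H →ₗ.[ℂ] H) (f g : A.domain) :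
    boundaryForm A g f = -(starRingEnd ℂ) (boundaryForm A f g) := by
  simp [boundaryForm]

theorem boundaryForm_eq_zero_comm {A : H →ₗ.[ℂ] H} {f g : A.domain} :
    boundaryForm A f g = 0 ↔ boundaryForm A g f = 0 := by
  rw [boundaryForm_swap A f g]; simp

theorem boundaryForm_add_right (A : H →ₗ.[ℂ] H) (f g g' : A.domain) :
    boundaryForm A f (g + g') = boundaryForm A f g + boundaryForm A f g' := by
  simp only [boundaryForm, LinearPMap.map_add, Submodule.coe_add, inner_add_left]; ring

theorem boundaryForm_smul_right (A : H →ₗ.[ℂ] H) (f g : A.domain) (c : ℂ) :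
    boundaryForm A f (c • g) = (starRingEnd ℂ) c * boundaryForm A f g := by
  simp only [boundaryForm, LinearPMap.map_smul, Submodule.coe_smul, inner_smul_left]; ring

theorem boundaryForm_sum_smul_right (A : H →ₗ.[ℂ] H) (f : A.domain) {ι : Type*} (s : Finset ι)
    (c : ι → ℂ) (g : ι → A.domain) (h : ∀ i ∈ s, boundaryForm A f (g i) = 0) :
    boundaryForm A f (∑ i ∈ s, c i • g i) = 0 := by
  classical
  induction s using Finset.induction_on with
  | empty => simp [boundaryForm]
  | insert j s hj ih =>
    rw [Finset.sum_insert hj, boundaryForm_add_right, boundaryForm_smul_right,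
      h j (Finset.mem_insert_self j s), ih fun i hi => h i (Finset.mem_insert_of_mem hi)]
    simp

/-- The operator `A + i` on the domain of `A`. -/
noncomputable def shift (A : H →ₗ.[ℂ] H) : A.domain →ₗ[ℂ] H :=
  A.toFun + Complex.I • A.domain.subtype

theorem shift_apply (A : H →ₗ.[ℂ] H) (x : A.domain) :
    shift A x = A x + Complex.I • (x : H) := rfl

/-- The inner product is conjugate linear in its first slot, so the shift by `+i` belongs to the
defect space at `+i`. -/
theorem mem_defectSpace_domRestrict {A : H →ₗ.[ℂ] H} {D : Submodule ℂ H} {v : H} :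
    v ∈ defectSpace (A.domRestrict D) Complex.I ↔
      ∀ x : A.domain, (x : H) ∈ D → inner ℂ (shift A x) v = 0 := by
  have key : ∀ x : A.domain, inner ℂ (shift A x) v =
      inner ℂ (A x) v - inner ℂ (x : H) (Complex.I • v) := fun x => by
    rw [shift_apply, inner_add_left, inner_smul_left, inner_smul_right, Complex.conj_I]; ring
  simp only [defectSpace, Submodule.mem_comap, Submodule.mem_adjoint_iff, key,
    LinearPMap.mem_graph_iff, LinearMap.prod_apply, Function.prod, LinearMap.id_apply,
    LinearMap.smul_apply]
  constructor
  · intro h x hx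
    exact h x (A x) ⟨⟨x, hx, x.2⟩, rfl, LinearPMap.domRestrict_apply rfl⟩
  · rintro h a b ⟨y, rfl, rfl⟩
    have hy : A.domRestrict D y = A ⟨y, y.2.2⟩ := LinearPMap.domRestrict_le.2 rfl
    rw [hy]
    exact h ⟨y, y.2.2⟩ y.2.1

theorem defectSpace_domRestrict_eq_orthogonal (A : H →ₗ.[ℂ] H) (D : Submodule ℂ H) :
    defectSpace (A.domRestrict D) Complex.I =
      ((D.comap A.domain.subtype).map (shift A))ᗮ := by
  ext v
  rw [mem_defectSpace_domRestrict, Submodule.mem_orthogonal]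
  constructor
  · rintro h _ ⟨x, hx, rfl⟩
    exact h x hx
  · intro h x hx
    exact h _ ⟨x, hx, rfl⟩

variable {L M : H →ₗ.[ℂ] H}

theorem boundaryForm_eq_of_le (hLM : L ≤ M) (x y : L.domain) :
    boundaryForm M ⟨x, hLM.1 x.2⟩ ⟨y, hLM.1 y.2⟩ = boundaryForm L x y := by
  rw [boundaryForm, boundaryForm, ← hLM.2 (x := x) rfl, ← hLM.2 (x := y) rfl]

theorem shift_eq_of_le (hLM : L ≤ M) {x : L.domain} {y : M.domain} (h : (x : H) = y) :
    shift L x = shift M y := by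
  rw [shift_apply, shift_apply, hLM.2 h, h]

/-- Finitely many vectors of a family with dense span project to a basis of a given
finite-dimensional subspace. -/
theorem exists_basis_orthogonalProjection {ι : Type*} (P : ι → H)
    (hP : Dense (Submodule.span ℂ (Set.range P) : Set H)) (K : Submodule ℂ H) {m : ℕ}
    (hK : Module.rank ℂ K = m) [K.HasOrthogonalProjection] :
    ∃ k : Fin m → ι, Function.Injective k ∧
      LinearIndependent ℂ (fun i => K.orthogonalProjectionOnto (P (k i))) ∧
      Submodule.span ℂ (Set.range fun i => K.orthogonalProjectionOnto (P (k i))) = ⊤ := by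
  have hfin : FiniteDimensional ℂ K := by
    rw [FiniteDimensional, ← Module.rank_lt_aleph0_iff, hK]; exact Cardinal.natCast_lt_aleph0
  have hspan : Submodule.span ℂ (Set.range fun i => K.orthogonalProjectionOnto (P i)) = ⊤ := by
    have hsurj : Function.Surjective K.orthogonalProjectionOnto := fun x =>
      ⟨x, K.orthogonalProjectionOnto_mem_subspace_eq_self x⟩
    have h1 := hsurj.denseRange.dense_image K.orthogonalProjectionOnto.continuous hP
    have h2 : (K.orthogonalProjectionOnto '' (Submodule.span ℂ (Set.range P) : Set H)) =
        (Submodule.span ℂ (Set.range fun i => K.orthogonalProjectionOnto (P i)) : Set K) := by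
      rw [← ContinuousLinearMap.coe_coe, ← Submodule.map_coe, Submodule.map_span,
        ← Set.range_comp]
      rfl
    -- A dense subspace of the finite-dimensional space `K` is closed, hence everything.
    rw [h2] at h1
    have h3 := (Submodule.closed_of_finiteDimensional
      (Submodule.span ℂ (Set.range fun i => K.orthogonalProjectionOnto (P i)))).closure_eq
    rw [h1.closure_eq] at h3
    exact SetLike.coe_injective h3.symm
  obtain ⟨κ, a, ha, hs, hli⟩ := exists_linearIndependent' ℂ fun i => K.orthogonalProjectionOnto (P i)
  rw [hspan] at hs
  let b := Module.Basis.mk hli hs.ge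
  have : Fintype κ := Module.Basis.fintypeIndexOfRankLtAleph0 b (by
    rw [hK]; exact Cardinal.natCast_lt_aleph0)
  have hcard : Fintype.card κ = m := by
    rw [← Module.finrank_eq_card_basis b]; exact Module.finrank_eq_of_rank_eq hK
  let e := (Fintype.equivFinOfCardEq hcard).symm
  refine ⟨a ∘ e, ha.comp e.injective, hli.comp e e.injective, ?_⟩
  rw [← hs, ← e.surjective.range_comp]
  rfl

/-! ### Self-adjoint operators below `M` -/

variable [CompleteSpace H]

theorem inner_apply_eq_of_isSelfAdjoint (hL : IsSelfAdjoint L) (x y : L.domain) :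
    inner ℂ (L x) (y : H) = inner ℂ (x : H) (L y) := by
  have h := LinearPMap.adjoint_isFormalAdjoint hL.dense_domain
  rw [LinearPMap.isSelfAdjoint_def.1 hL] at h
  exact h x y

theorem boundaryForm_eq_zero_of_isSelfAdjoint (hL : IsSelfAdjoint L) (x y : L.domain) :
    boundaryForm L x y = 0 := by
  rw [boundaryForm, inner_apply_eq_of_isSelfAdjoint hL, sub_self]

/-- `⟪L x, x⟫` is real, so the cross term `2 Re ⟪L x, i x⟫` vanishes. -/
theorem norm_shift_sq (hL : IsSelfAdjoint L) (x : L.domain) :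
    ‖shift L x‖ ^ 2 = ‖L x‖ ^ 2 + ‖(x : H)‖ ^ 2 := by
  have h := inner_apply_eq_of_isSelfAdjoint hL x x
  have h0 : RCLike.re (inner ℂ (L x) (Complex.I • (x : H))) = 0 := by
    have him : (inner ℂ (L x) (x : H)).im = 0 := by
      rw [← Complex.conj_eq_iff_im, inner_conj_symm, ← h]
    rw [inner_smul_right]
    simp [him]
  rw [shift_apply, norm_add_sq (𝕜 := ℂ), h0, norm_smul]
  simp

theorem norm_le_norm_shift (hL : IsSelfAdjoint L) (x : L.domain) : ‖(x : H)‖ ≤ ‖shift L x‖ := by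
  have := norm_shift_sq hL x
  exact le_of_sq_le_sq (by nlinarith [sq_nonneg ‖L x‖]) (norm_nonneg _)

theorem eigenvalue_add_I_ne_zero (hL : IsSelfAdjoint L) {x : L.domain} (hx : (x : H) ≠ 0) {c : ℂ}
    (hc : L x = c • (x : H)) : c + Complex.I ≠ 0 := by
  intro h
  have h1 := norm_le_norm_shift hL x
  rw [shift_apply, hc, ← add_smul, h, zero_smul, norm_zero] at h1
  exact hx (norm_le_zero_iff.1 h1)

/-- The hypothesis reads `⟪M f, x⟫ = ⟪f, L x⟫` on the domain of `L`, so `f` lies in the domain of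
`L* = L`. -/
theorem mem_domain_of_boundaryForm_eq_zero (hL : IsSelfAdjoint L) (hLM : L ≤ M) (f : M.domain)
    (h : ∀ g : L.domain, boundaryForm M f ⟨g, hLM.1 g.2⟩ = 0) : (f : H) ∈ L.domain := by
  rw [← LinearPMap.isSelfAdjoint_def.1 hL]
  refine LinearPMap.mem_adjoint_domain_of_exists _ ⟨M f, fun x => ?_⟩
  have h1 := boundaryForm_eq_zero_comm.1 (h x)
  rw [boundaryForm, sub_eq_zero, ← hLM.2 (x := x) rfl] at h1
  exact h1.symm

/-- If `D` is the domain on which the boundary form of `M` vanishes against everything, then `L + i`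
maps no element outside of `D` to the orthogonal complement of the defect space. -/
theorem mem_of_shift_mem_orthogonal (hL : IsSelfAdjoint L) (hLM : L ≤ M) {D : Submodule ℂ H}
    (hDL : D ≤ L.domain)
    (hD : ∀ f : M.domain, (f : H) ∈ D ↔ ∀ g, boundaryForm M f g = 0) (u : L.domain)
    (hu : shift L u ∈ (defectSpace (M.domRestrict D) Complex.I)ᗮ) : (u : H) ∈ D := by
  -- The complement of the defect space is the closure of `(M + i) D`, so `(L + i) u` is a limit of
  -- `(L + i) t_k` with `t_k ∈ D`.
  rw [defectSpace_domRestrict_eq_orthogonal, Submodule.orthogonal_orthogonal_eq_closure,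
    ← SetLike.mem_coe, Submodule.topologicalClosure_coe, mem_closure_iff_seq_limit] at hu
  obtain ⟨y, hy, hlim⟩ := hu
  choose s hs hsy using hy
  let t : ℕ → L.domain := fun k => ⟨s k, hDL (hs k)⟩
  have hty : ∀ k, shift L (t k) = y k := fun k => by
    rw [← hsy k]; exact shift_eq_of_le hLM rfl
  -- The lower bound on `L + i` turns convergence of the images into graph convergence of `t_k` to
  -- `u`; the form against a fixed `g` is continuous for it.
  have h1 : Tendsto (fun k => (t k : H)) atTop (𝓝 (u : H)) := by
    rw [tendsto_iff_norm_sub_tendsto_zero] at hlim ⊢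
    refine squeeze_zero (fun _ => norm_nonneg _) (fun k => ?_) hlim
    have := norm_le_norm_shift hL (t k - u)
    rwa [map_sub, hty, Submodule.coe_sub] at this
  have h2 : Tendsto (fun k => L (t k)) atTop (𝓝 (L u)) := by
    have := hlim.sub (h1.const_smul Complex.I)
    simpa [← hty, shift_apply] using this
  refine (hD ⟨u, hLM.1 u.2⟩).2 fun g => ?_
  have h3 : Tendsto (fun k => inner ℂ (g : H) (L (t k)) - inner ℂ (M g) (t k : H)) atTop
      (𝓝 (inner ℂ (g : H) (L u) - inner ℂ (M g) (u : H))) :=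
    (tendsto_const_nhds.inner h2).sub (tendsto_const_nhds.inner h1)
  have h4 : ∀ k, inner ℂ (g : H) (L (t k)) - inner ℂ (M g) (t k : H) = 0 := fun k => by
    have := (hD (s k)).1 (hs k) g
    rwa [boundaryForm, ← hLM.2 (x := t k) (y := s k) rfl] at this
  simp only [h4] at h3
  rw [boundaryForm, ← hLM.2 (x := u) rfl]
  exact tendsto_nhds_unique h3 tendsto_const_nhds

/-- The Glazman-Krein-Naimark description, by eigenvectors, of a self-adjoint operator `L` that lies
between an operator `M` and the restriction of `M` to the radical `D` of its boundary form. -/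
theorem exists_eigenvectors_boundary_conditions (hL : IsSelfAdjoint L) (hLM : L ≤ M)
    {D : Submodule ℂ H} (hDL : D ≤ L.domain)
    (hD : ∀ f : M.domain, (f : H) ∈ D ↔ ∀ g, boundaryForm M f g = 0)
    {m : ℕ} (hm : Module.rank ℂ (defectSpace (M.domRestrict D) Complex.I) = m)
    {ι : Type*} (P : ι → L.domain) (hP0 : ∀ k, (P k : H) ≠ 0)
    (hPeig : ∀ k, ∃ lam : ℂ, L (P k) = lam • (P k : H))
    (hPdense : Dense (Submodule.span ℂ (Set.range fun k => (P k : H)) : Set H)) :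
    ∃ k : Fin m → ι, Function.Injective k ∧
      LinIndepModulo D (fun i => (P (k i) : H)) ∧
      ∀ f : M.domain, (f : H) ∈ L.domain ↔
        ∀ i, boundaryForm M f ⟨P (k i), hLM.1 (P (k i)).2⟩ = 0 := by
  choose lam hlam using hPeig
  set K := defectSpace (M.domRestrict D) Complex.I with hKdef
  have hfin : FiniteDimensional ℂ K := by
    rw [FiniteDimensional, ← Module.rank_lt_aleph0_iff, hm]; exact Cardinal.natCast_lt_aleph0
  obtain ⟨k, hk, hli, hsp⟩ := exists_basis_orthogonalProjection _ hPdense K hm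
  have hne : ∀ i, lam i + Complex.I ≠ 0 := fun i => eigenvalue_add_I_ne_zero hL (hP0 i) (hlam i)
  have hshift : ∀ i, shift L (P i) = (lam i + Complex.I) • (P i : H) := fun i => by
    rw [shift_apply, hlam, add_smul]
  have hshift_sum : ∀ c : Fin m → ℂ, K.orthogonalProjectionOnto (shift L (∑ i, c i • P (k i))) =
      ∑ i, (c i * (lam (k i) + Complex.I)) • K.orthogonalProjectionOnto (P (k i) : H) := fun c => by
    simp only [map_sum, map_smul, hshift, smul_smul]
  refine ⟨k, hk, ?_, fun f => ⟨fun hf i => ?_, fun hf => ?_⟩⟩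
  · intro c hc
    have h1 : shift L (∑ i, c i • P (k i)) ∈ Kᗮ := by
      rw [hKdef, defectSpace_domRestrict_eq_orthogonal]
      refine Submodule.le_orthogonal_orthogonal _
        ⟨⟨∑ i, c i • (P (k i) : H), hLM.1 (hDL hc)⟩, hc, (shift_eq_of_le hLM ?_).symm⟩
      simp
    have h2 := hshift_sum c
    rw [Submodule.orthogonalProjectionOnto_apply_of_mem_orthogonal h1] at h2
    intro i
    have := Fintype.linearIndependent_iff.1 hli _ h2.symm i
    exact (mul_eq_zero.1 this).resolve_right (hne _)
  · exact (boundaryForm_eq_of_le hLM ⟨f, hf⟩ (P (k i))).trans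
      (boundaryForm_eq_zero_of_isSelfAdjoint hL _ _)
  · refine mem_domain_of_boundaryForm_eq_zero hL hLM f fun g => ?_
    have hmem : K.orthogonalProjectionOnto (shift L g) ∈
        Submodule.span ℂ (Set.range fun i => K.orthogonalProjectionOnto (P (k i) : H)) := by
      rw [hsp]; trivial
    obtain ⟨d, hd⟩ := (Submodule.mem_span_range_iff_exists_fun ℂ).1 hmem
    -- Dividing by `λ + i` undoes the factor that `L + i` puts on each eigenvector, so subtracting
    -- this combination removes the `K`-component of `(L + i) g`.
    set c : Fin m → ℂ := fun i => d i / (lam (k i) + Complex.I) with hc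
    have hgc : K.orthogonalProjectionOnto (shift L (g - ∑ i, c i • P (k i))) = 0 := by
      rw [map_sub, map_sub, hshift_sum, ← hd, sub_eq_zero]
      refine Finset.sum_congr rfl fun i _ => ?_
      rw [hc, div_mul_cancel₀ _ (hne _)]
    have hsD := mem_of_shift_mem_orthogonal hL hLM hDL hD _
      (Submodule.orthogonalProjectionOnto_eq_zero_iff.1 hgc)
    set s := g - ∑ i, c i • P (k i) with hs
    have hg : (⟨g, hLM.1 g.2⟩ : M.domain) = ⟨s, hLM.1 s.2⟩ +
        ∑ i, c i • (⟨P (k i), hLM.1 (P (k i)).2⟩ : M.domain) := by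
      apply Subtype.ext
      simp [hs]
    rw [hg, boundaryForm_add_right, boundaryForm_sum_smul_right M f _ _ _ fun i _ => hf i,
      boundaryForm_eq_zero_comm.1 ((hD ⟨s, hLM.1 s.2⟩).1 hsD f), add_zero]

end Abstract

/-! ### The boundary form of `ℓ^n` as a limit at the endpoints -/

namespace SymmExpr

/-- Nontriviality of the endpoint filters is what makes the limit defining `[f, g]` unique. -/
theorem comap_nhdsGT_neBot {a b : EReal} (h : a < b) : (comap Real.toEReal (𝓝[>] a)).NeBot := by
  rw [comap_neBot_iff]
  intro t ht
  obtain ⟨u, hu, hsub⟩ := (mem_nhdsGT_iff_exists_Ioo_subset' h).1 ht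
  obtain ⟨x, hx⟩ := EReal.lt_iff_exists_real_btwn.1 hu
  exact ⟨x, hsub hx⟩

theorem comap_nhdsLT_neBot {a b : EReal} (h : a < b) : (comap Real.toEReal (𝓝[<] b)).NeBot := by
  rw [comap_neBot_iff]
  intro t ht
  obtain ⟨u, hu, hsub⟩ := (mem_nhdsLT_iff_exists_Ioo_subset' h).1 ht
  obtain ⟨x, hx⟩ := EReal.lt_iff_exists_real_btwn.1 hu
  exact ⟨x, hsub hx⟩

theorem eventually_comap_nhdsGT_lt {a : EReal} {x : ℝ} (h : a < x) :
    ∀ᶠ t in comap Real.toEReal (𝓝[>] a), t < x := by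
  filter_upwards [preimage_mem_comap (mem_nhdsWithin_of_mem_nhds (Iio_mem_nhds h))] with t ht
  exact EReal.coe_lt_coe_iff.1 ht

theorem eventually_comap_nhdsLT_gt {b : EReal} {x : ℝ} (h : (x : EReal) < b) :
    ∀ᶠ t in comap Real.toEReal (𝓝[<] b), x < t := by
  filter_upwards [preimage_mem_comap (mem_nhdsWithin_of_mem_nhds (Ioi_mem_nhds h))] with t ht
  exact EReal.coe_lt_coe_iff.1 ht

variable {N : ℕ} {τ : SymmExpr N} {n : ℕ}

theorem ae_weightMeasure_mem_interval : ∀ᵐ x ∂τ.weightMeasure, x ∈ interval τ.a τ.b :=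
  (withDensity_absolutelyContinuous _ _).ae_le
    (ae_restrict_mem (isOpen_interval _ _).measurableSet)

theorem tendsto_intervalIntegral_weightMeasure {f : ℝ → ℂ} (hf : Integrable f τ.weightMeasure) :
    Tendsto (fun t : ℝ × ℝ => ∫ x in t.1..t.2, f x ∂τ.weightMeasure)
      (comap Real.toEReal (𝓝[>] τ.a) ×ˢ comap Real.toEReal (𝓝[<] τ.b))
      (𝓝 (∫ x, f x ∂τ.weightMeasure)) := by
  have hcover : AECover τ.weightMeasure
      (comap Real.toEReal (𝓝[>] τ.a) ×ˢ comap Real.toEReal (𝓝[<] τ.b))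
      (fun t : ℝ × ℝ => Set.Ioc t.1 t.2) := by
    refine ⟨?_, fun _ => measurableSet_Ioc⟩
    filter_upwards [ae_weightMeasure_mem_interval] with x hx
    filter_upwards [(eventually_comap_nhdsGT_lt hx.1).prod_mk (eventually_comap_nhdsLT_gt hx.2)]
      with t ht
    exact ⟨ht.1, ht.2.le⟩
  refine (hcover.integral_tendsto_of_countably_generated hf).congr' ?_
  -- A real `c` between the endpoints eventually separates `α < c < β`, so the oriented integral is
  -- the integral over `Ioc α β`.
  obtain ⟨c, hc⟩ := EReal.lt_iff_exists_real_btwn.1 τ.a_lt_b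
  filter_upwards [(eventually_comap_nhdsGT_lt hc.1).prod_mk (eventually_comap_nhdsLT_gt hc.2)]
    with t ht
  exact (intervalIntegral.integral_of_le (ht.1.trans ht.2).le).symm

/-- All four functions are in `L²`, so the Green integrand is integrable on the whole interval and
the limit always exists; its two terms integrate to inner products. -/
theorem hasBoundaryForm_boundaryForm (f g : (τ.maxOp n).domain) :
    HasBoundaryForm f g (boundaryForm (τ.maxOp n) f g) := by
  have h := tendsto_intervalIntegral_weightMeasure (integrable_green f g)
  have hi : ∫ x, ((τ.maxOp n f : τ.Space) x * (starRingEnd ℂ) ((g : τ.Space) x)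
      - (starRingEnd ℂ) ((τ.maxOp n g : τ.Space) x) * (f : τ.Space) x) ∂τ.weightMeasure =
      boundaryForm (τ.maxOp n) f g := by
    rw [integral_sub (integrable_mul_conj _ _)
      (by simpa only [mul_comm] using integrable_mul_conj (f : τ.Space) (τ.maxOp n g)),
      boundaryForm, L2.inner_def, L2.inner_def]
    simp only [RCLike.inner_apply, mul_comm]
  rwa [hi] at h

theorem hasBoundaryForm_iff {f g : (τ.maxOp n).domain} {c : ℂ} :
    HasBoundaryForm f g c ↔ boundaryForm (τ.maxOp n) f g = c := by
  have := comap_nhdsGT_neBot τ.a_lt_b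
  have := comap_nhdsLT_neBot τ.a_lt_b
  refine ⟨fun h => tendsto_nhds_unique (hasBoundaryForm_boundaryForm f g) h, ?_⟩
  rintro rfl
  exact hasBoundaryForm_boundaryForm f g

theorem mem_minDomain_iff (f : (τ.maxOp n).domain) :
    (f : τ.Space) ∈ τ.minDomain n ↔ ∀ g, boundaryForm (τ.maxOp n) f g = 0 := by
  simp only [← hasBoundaryForm_iff]
  constructor
  · rintro ⟨f', hf', h⟩
    obtain rfl : f' = f := Subtype.ext h
    exact hf'
  · exact fun h => ⟨f, h, rfl⟩

theorem minDomain_le : τ.minDomain n ≤ (τ.maxOp n).domain := by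
  rintro _ ⟨f, _, rfl⟩
  exact f.2

end SymmExpr

end GKN

theorem theorem5p1 {N : ℕ} (hN : 1 ≤ N) (τ : GKN.SymmExpr N) (n : ℕ) (hn : 1 ≤ n)
    (L : τ.Space →ₗ.[ℂ] τ.Space) (hL : IsSelfAdjoint L)
    (hmax : L ≤ τ.maxOp n) (hmin : τ.minOp n ≤ L)
    (m : ℕ) (hm : GKN.HasDeficiencyIndices (τ.minOp n) m)
    (P : ℕ → (τ.maxOp n).domain)
    (hPL : ∀ k, (P k : τ.Space) ∈ L.domain)
    (hP0 : ∀ k, (P k : τ.Space) ≠ 0)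
    (hPeig : ∀ k, ∃ lam : ℂ, L ⟨P k, hPL k⟩ = lam • (P k : τ.Space))
    (hPorth : ∀ j k, j ≠ k → inner ℂ (P j : τ.Space) (P k : τ.Space) = 0)
    (hPcomplete : Dense
      (Submodule.span ℂ (Set.range fun k => (P k : τ.Space)) : Set τ.Space)) :
    ∃ k : Fin m → ℕ, Function.Injective k ∧
      GKN.LinIndepModulo (τ.minDomain n) (fun i => (P (k i) : τ.Space)) ∧
      (∀ i j, GKN.SymmExpr.HasBoundaryForm (P (k i)) (P (k j)) 0) ∧
      (L.domain : Set τ.Space) =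
        {f | ∃ hf : f ∈ (τ.maxOp n).domain,
          ∀ i, GKN.SymmExpr.HasBoundaryForm ⟨f, hf⟩ (P (k i)) 0} := by
  have hDL : τ.minDomain n ≤ L.domain := fun x hx =>
    hmin.1 ⟨hx, GKN.SymmExpr.minDomain_le hx⟩
  obtain ⟨k, hk, hli, hdom⟩ := GKN.exists_eigenvectors_boundary_conditions hL hmax hDL
    GKN.SymmExpr.mem_minDomain_iff hm.1 (fun j => ⟨P j, hPL j⟩) hP0 hPeig hPcomplete
  refine ⟨k, hk, hli, fun i j => ?_, ?_⟩
  -- Glazman symmetry: each chosen eigenfunction lies in `D_L`, hence satisfies the boundary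
  -- conditions itself.
  · exact GKN.SymmExpr.hasBoundaryForm_iff.2 ((hdom (P (k i))).1 (hPL (k i)) j)
  · ext f
    simp only [GKN.SymmExpr.hasBoundaryForm_iff, SetLike.mem_coe, Set.mem_ofPred_eq]
    exact ⟨fun hf => ⟨hmax.1 hf, (hdom ⟨f, hmax.1 hf⟩).1 hf⟩, fun ⟨hf, h⟩ => (hdom ⟨f, hf⟩).2 h⟩
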